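/- Let $R$ be a finite associative ring, not necessarily having a multiplicative identity. Let $\widehat R$ be the multiplicative abelian group of all characters of $R$, that is, group homomorphisms $\pi:(R,+)\to\mathbb{C}^\times$. It is an $R$-bimodule, with scalar multiplications written ${}^r\pi$ (left) and $\pi^r$ (right) and given for $r,s\in R$ by ${}^r\pi(s)=\pi(sr)$ and $\pi^r(s)=\pi(rs)$. Suppose that there is a character $\chi\in\widehat R$ such that $r\mapsto\chi^r$ is an isomorphism $R\to\widehat R$ of right $R$-modules, or such that $r\mapsto{}^r\chi$ is an isomorphism $R\to\widehat R$ of left $R$-modules. Then $R$ has a two-sided multiplicative identity, and with this identity $R$ is a Frobenius ring: $R$ is left and right Artinian, $\operatorname{Soc}({}_RR)\cong R/\operatorname{rad}R$ as left $R$-modules, and $\operatorname{Soc}(R_R)\cong R/\operatorname{rad}R$ as right $R$-modules, where $\operatorname{Soc}$ denotes the socle (the sum of all simple submodules) and $\operatorname{rad}R$ the Jacobson radical of $R$. -/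

import Mathlib

namespace GenChar

/-! ### Characters of the additive group of a finite rng

`AddChar R ℂ` is the multiplicative group of homomorphisms from the additive group of `R` to the
multiplicative monoid of `ℂ`; as `R` is a group, the values are automatically in `ℂˣ`. -/

section Characters

variable {R : Type*} [NonUnitalRing R]

/-- The right scalar multiple `π ^ r` of a character: `⟨π ^ r, s⟩ = ⟨π, r * s⟩`. -/
def rightAct (π : AddChar R ℂ) (r : R) : AddChar R ℂ where
  toFun s := π (r * s)
  map_zero_eq_one' := by simp
  map_add_eq_mul' s t := by rw [mul_add, AddChar.map_add_eq_mul]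

/-- The left scalar multiple `ʳπ` of a character: `⟨ʳπ, s⟩ = ⟨π, s * r⟩`. -/
def leftAct (r : R) (π : AddChar R ℂ) : AddChar R ℂ where
  toFun s := π (s * r)
  map_zero_eq_one' := by simp
  map_add_eq_mul' s t := by rw [add_mul, AddChar.map_add_eq_mul]

/-- `f : R → R̂` is an isomorphism of right `R`-modules; the group `R̂` is written
multiplicatively. -/
structure IsRightModuleIso (f : R → AddChar R ℂ) : Prop where
  map_add : ∀ r s : R, f (r + s) = f r * f s
  map_act : ∀ r s : R, f (r * s) = rightAct (f r) s
  bijective : Function.Bijective f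

/-- `f : R → R̂` is an isomorphism of left `R`-modules; the group `R̂` is written
multiplicatively. -/
structure IsLeftModuleIso (f : R → AddChar R ℂ) : Prop where
  map_add : ∀ r s : R, f (r + s) = f r * f s
  map_act : ∀ r s : R, f (r * s) = leftAct r (f s)
  bijective : Function.Bijective f

/-- `e` is a two-sided multiplicative identity of the rng `R`. -/
def IsIdentity (e : R) : Prop :=
  ∀ r : R, e * r = r ∧ r * e = r

/-- The ring with underlying rng `R` and with `1 = e`, for an identity `e` of `R`. -/
abbrev ringOfIdentity (e : R) (he : IsIdentity e) : Ring R :=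
  { (inferInstance : NonUnitalRing R) with
    one := e
    one_mul := fun r => (he r).1
    mul_one := fun r => (he r).2 }

end Characters

/-! ### Frobenius rings -/

/-- The socle of a module: the sum of its minimal nonzero (that is, simple) submodules. -/
def socle (R M : Type*) [Ring R] [AddCommGroup M] [Module R M] : Submodule R M :=
  sSup {m : Submodule R M | IsAtom m}

/-- A ring with `1` is Frobenius if it is left and right Artinian, its left socle is isomorphic to
`R / rad R` as a left module, and its right socle is isomorphic to `R / rad R` as a right module.
Right `R`-modules are modules over `Rᵐᵒᵖ`; `Module.jacobson R R` (resp. `Module.jacobson Rᵐᵒᵖ R`) is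
the intersection of the maximal left (resp. right) ideals, and both are the Jacobson radical. -/
structure IsFrobeniusRing (R : Type*) [Ring R] : Prop where
  artinian_left : IsArtinian R R
  artinian_right : IsArtinian Rᵐᵒᵖ R
  socle_left : Nonempty (socle R R ≃ₗ[R] (R ⧸ Module.jacobson R R))
  socle_right : Nonempty (socle Rᵐᵒᵖ R ≃ₗ[Rᵐᵒᵖ] (R ⧸ Module.jacobson Rᵐᵒᵖ R))

end GenChar

/-!
The module isomorphism says that `χ` is nondegenerate: no nonzero `x` has `R * x` (equivalently
`x * R`) inside the kernel of `χ`, and every character of `R` has the form `s ↦ χ (s * c)`.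
Representing `χ` itself this way produces the identity element.

Let `J` be the Jacobson radical. By Wedderburn–Artin the semisimple ring `R ⧸ J` is a product of
matrix rings over finite division rings; composing the trace with a nontrivial character on each
factor gives a nondegenerate character `θ` of `R ⧸ J`. Its inflation to `R` is `s ↦ χ (s * c)` for
some `c`. Right multiplication by `c` then has kernel `J`, and its image is `{x | J x = 0}`, because
the characters `s ↦ χ (s * x)` that are trivial on `J` are exactly those coming from `R ⧸ J`. This
image is the left socle. The right socle is the left socle of the opposite ring.
-/

namespace GenChar

theorem addChar_sub_eq_one_iff {A M : Type*} [AddCommGroup A] [DivisionCommMonoid M]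
    (χ : AddChar A M) (a b : A) : χ (a - b) = 1 ↔ χ a = χ b := by
  rw [AddChar.map_sub_eq_div, (χ.val_isUnit b).div_eq_one_iff_eq]

theorem exists_addChar_quotient_apply_mk_eq {A M : Type*} [AddGroup A] [Monoid M]
    (H : AddSubgroup A) [H.Normal] (π : AddChar A M) (hπ : ∀ a ∈ H, π a = 1) :
    ∃ ψ : AddChar (A ⧸ H) M, ∀ a : A, ψ (a : A ⧸ H) = π a :=
  ⟨AddChar.toAddMonoidHomEquiv.symm <|
    QuotientAddGroup.lift H (AddChar.toAddMonoidHomEquiv π) hπ, fun _ => rfl⟩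

section Nondegenerate

variable {R : Type*} [NonUnitalRing R] {χ : AddChar R ℂ}

/-- A character `χ` of `R` is left nondegenerate if its kernel contains no `R * x` with `x ≠ 0`.
For a rng with identity this says that the kernel contains no nonzero left ideal. -/
def IsLeftNondegenerate (χ : AddChar R ℂ) : Prop :=
  ∀ x : R, (∀ s : R, χ (s * x) = 1) → x = 0

/-- A character `χ` of `R` is right nondegenerate if its kernel contains no `x * R` with `x ≠ 0`.
For a rng with identity this says that the kernel contains no nonzero right ideal. -/
def IsRightNondegenerate (χ : AddChar R ℂ) : Prop :=
  ∀ x : R, (∀ s : R, χ (x * s) = 1) → x = 0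

theorem isLeftNondegenerate_iff_injective_leftAct :
    IsLeftNondegenerate χ ↔ Function.Injective fun r : R => leftAct r χ := by
  refine ⟨fun h a b hab => sub_eq_zero.1 <| h _ fun s => ?_,
    fun h x hx => h <| DFunLike.ext _ _ fun s => ?_⟩
  · rw [mul_sub, addChar_sub_eq_one_iff]
    exact DFunLike.congr_fun hab s
  · change χ (s * x) = χ (s * 0)
    rw [hx, mul_zero, AddChar.map_zero_eq_one]

theorem isRightNondegenerate_iff_injective_rightAct :
    IsRightNondegenerate χ ↔ Function.Injective fun r : R => rightAct χ r := by
  refine ⟨fun h a b hab => sub_eq_zero.1 <| h _ fun s => ?_,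
    fun h x hx => h <| DFunLike.ext _ _ fun s => ?_⟩
  · rw [sub_mul, addChar_sub_eq_one_iff]
    exact DFunLike.congr_fun hab s
  · change χ (x * s) = χ (0 * s)
    rw [hx, zero_mul, AddChar.map_zero_eq_one]

theorem IsLeftNondegenerate.forall_apply_mul_eq_one_iff (h : IsLeftNondegenerate χ) {x : R} :
    (∀ s : R, χ (s * x) = 1) ↔ x = 0 :=
  ⟨h x, by rintro rfl s; rw [mul_zero, AddChar.map_zero_eq_one]⟩

theorem IsLeftNondegenerate.exists_forall_apply_eq [Finite R] (h : IsLeftNondegenerate χ)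
    (π : AddChar R ℂ) : ∃ c : R, ∀ s : R, π s = χ (s * c) := by
  have := Fintype.ofFinite R
  have hbij : Function.Bijective fun r : R => leftAct r χ :=
    (Fintype.bijective_iff_injective_and_card _).2
      ⟨isLeftNondegenerate_iff_injective_leftAct.1 h, AddChar.card_eq.symm⟩
  obtain ⟨c, rfl⟩ := hbij.surjective π
  exact ⟨c, fun _ => rfl⟩

/-- The character `χ` of `R`, regarded as a character of the opposite rng; it exchanges left and
right. -/
def opChar (χ : AddChar R ℂ) : AddChar Rᵐᵒᵖ ℂ :=
  χ.compAddMonoidHom (MulOpposite.opAddEquiv (α := R)).symm.toAddMonoidHom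

theorem isLeftNondegenerate_opChar_iff :
    IsLeftNondegenerate (opChar χ) ↔ IsRightNondegenerate χ := by
  simp only [IsLeftNondegenerate, IsRightNondegenerate, MulOpposite.opEquiv.surjective.forall]
  exact forall_congr' fun x => imp_congr Iff.rfl (MulOpposite.op_eq_zero_iff x)

theorem IsRightNondegenerate.exists_forall_apply_eq [Finite R] (h : IsRightNondegenerate χ)
    (π : AddChar R ℂ) : ∃ c : R, ∀ s : R, π s = χ (c * s) := by
  have : Finite Rᵐᵒᵖ := .of_equiv R MulOpposite.opEquiv
  obtain ⟨c, hc⟩ := (isLeftNondegenerate_opChar_iff.2 h).exists_forall_apply_eq (opChar π)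
  exact ⟨c.unop, fun s => hc (MulOpposite.op s)⟩

theorem isLeftNondegenerate_iff_isRightNondegenerate [Finite R] :
    IsLeftNondegenerate χ ↔ IsRightNondegenerate χ := by
  refine ⟨fun h x hx => ?_, fun h x hx => ?_⟩ <;>
  · refine AddChar.forall_apply_eq_zero.1 fun π => ?_
    obtain ⟨c, hc⟩ := h.exists_forall_apply_eq π
    rw [hc, hx]

theorem IsRightNondegenerate.exists_isIdentity [Finite R] (h : IsRightNondegenerate χ) :
    ∃ e : R, IsIdentity e := by
  obtain ⟨e, he⟩ := h.exists_forall_apply_eq χ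
  have hinj := isRightNondegenerate_iff_injective_rightAct.1 h
  have left_identity (r : R) : e * r = r := hinj <| DFunLike.ext _ _ fun s => by
    change χ (e * r * s) = χ (r * s)
    rw [mul_assoc, ← he]
  have right_identity (r : R) : r * e = r := hinj <| DFunLike.ext _ _ fun s => by
    change χ (r * e * s) = χ (r * s)
    rw [mul_assoc, left_identity]
  exact ⟨e, fun r => ⟨left_identity r, right_identity r⟩⟩

theorem IsLeftNondegenerate.comp_ringEquiv {S : Type*} [NonUnitalRing S]
    (h : IsLeftNondegenerate χ) (e : S ≃+* R) :
    IsLeftNondegenerate (χ.compAddMonoidHom e.toAddEquiv.toAddMonoidHom) := fun x hx =>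
  (map_eq_zero_iff e e.injective).1 <| h _ fun s => by
    simpa using hx (e.symm s)

end Nondegenerate

theorem exists_isLeftNondegenerate_of_divisionRing (D : Type*) [DivisionRing D] [Finite D] :
    ∃ θ : AddChar D ℂ, IsLeftNondegenerate θ := by
  obtain ⟨θ, hθ⟩ := AddChar.exists_apply_ne_zero.2 (one_ne_zero (α := D))
  refine ⟨θ, fun x hx => by_contra fun hx0 => hθ ?_⟩
  rw [← inv_mul_cancel₀ hx0, hx]

theorem exists_isLeftNondegenerate_matrix {D n : Type*} [NonUnitalRing D] [Fintype n]
    (h : ∃ θ : AddChar D ℂ, IsLeftNondegenerate θ) :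
    ∃ θ : AddChar (Matrix n n D) ℂ, IsLeftNondegenerate θ := by
  classical
  obtain ⟨θ, hθ⟩ := h
  refine ⟨θ.compAddMonoidHom (Matrix.traceAddMonoidHom n D), fun A hA => ?_⟩
  ext i j
  refine hθ _ fun s => ?_
  have trace_eq : (Matrix.single j i s * A).trace = s * A i j := Matrix.trace_single_mul ..
  rw [← trace_eq]
  exact hA (Matrix.single j i s)

theorem exists_isLeftNondegenerate_pi {ι : Type*} [Finite ι] {S : ι → Type*}
    [∀ i, NonUnitalRing (S i)] (h : ∀ i, ∃ θ : AddChar (S i) ℂ, IsLeftNondegenerate θ) :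
    ∃ θ : AddChar (∀ i, S i) ℂ, IsLeftNondegenerate θ := by
  classical
  have := Fintype.ofFinite ι
  choose θ hθ using h
  let Θ : AddChar (∀ i, S i) ℂ := ∏ i, (θ i).compAddMonoidHom (Pi.evalAddMonoidHom S i)
  have apply_single_mul (x : ∀ i, S i) (i : ι) (s : S i) :
      Θ (Pi.single i s * x) = θ i (s * x i) := by
    rw [AddChar.prod_apply, Finset.prod_eq_single i _ (by simp)]
    · simp
    · intro j _ hj
      simp [hj]
  refine ⟨Θ, fun x hx => funext fun i => hθ i _ fun s => ?_⟩
  rw [← apply_single_mul, hx]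

theorem exists_isLeftNondegenerate_of_isSemisimpleRing (S : Type*) [Ring S] [Finite S]
    [IsSemisimpleRing S] : ∃ θ : AddChar S ℂ, IsLeftNondegenerate θ := by
  obtain ⟨n, D, d, _, _, ⟨e⟩⟩ := IsSemisimpleRing.exists_ringEquiv_pi_matrix_divisionRing S
  have (i : Fin n) : Finite (D i) :=
    Finite.of_surjective (fun s : S => e s i 0 0) fun x =>
      ⟨e.symm (Pi.single i (Matrix.of fun _ _ => x)), by simp⟩
  obtain ⟨θ, hθ⟩ := exists_isLeftNondegenerate_pi fun i =>
    exists_isLeftNondegenerate_matrix (n := Fin (d i))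
      (exists_isLeftNondegenerate_of_divisionRing (D i))
  exact ⟨_, hθ.comp_ringEquiv e⟩

section Socle

variable {R M N : Type*} [Ring R] [AddCommGroup M] [Module R M] [AddCommGroup N] [Module R N]

instance isSemisimpleModule_socle : IsSemisimpleModule R (socle R M) := by
  rw [socle, sSup_eq_iSup]
  refine isSemisimpleModule_biSup_of_isSemisimpleModule_submodule fun m hm => ?_
  have : IsSimpleModule R m := isSimpleModule_iff_isAtom.2 hm
  infer_instance

theorem le_socle_iff_isSemisimpleModule {m : Submodule R M} :
    m ≤ socle R M ↔ IsSemisimpleModule R m := by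
  refine ⟨fun h => .of_injective _ (Submodule.inclusion_injective h), fun _ => ?_⟩
  rw [← Submodule.map_subtype_top m, ← IsSemisimpleModule.sSup_simples_eq_top R m, sSup_eq_iSup',
    Submodule.map_iSup]
  refine iSup_le fun ⟨a, ha⟩ => le_sSup (isSimpleModule_iff_isAtom.1 ?_)
  have : IsSimpleModule R a := ha
  exact .congr (Submodule.equivMapOfInjective m.subtype m.subtype_injective a).symm

theorem map_socle_le (f : M →ₗ[R] N) : (socle R M).map f ≤ socle R N :=
  le_socle_iff_isSemisimpleModule.2 <|
    .of_surjective (f.submoduleMap _) (f.submoduleMap_surjective _)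

theorem map_socle_equiv (e : M ≃ₗ[R] N) : (socle R M).map (e : M →ₗ[R] N) = socle R N := by
  refine le_antisymm (map_socle_le _) fun y hy => ⟨e.symm y, ?_, e.apply_symm_apply y⟩
  exact map_socle_le (e.symm : N →ₗ[R] M) ⟨y, hy, rfl⟩

theorem nonempty_socle_equiv_quotient_jacobson_congr (e : M ≃ₗ[R] N)
    (h : Nonempty (socle R M ≃ₗ[R] M ⧸ Module.jacobson R M)) :
    Nonempty (socle R N ≃ₗ[R] N ⧸ Module.jacobson R N) := by
  obtain ⟨f⟩ := h
  let socleEquiv : socle R M ≃ₗ[R] socle R N := e.ofSubmodules _ _ (map_socle_equiv e)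
  let quotientEquiv : (M ⧸ Module.jacobson R M) ≃ₗ[R] N ⧸ Module.jacobson R N :=
    Submodule.Quotient.equiv _ _ e (Module.map_jacobson_of_bijective e.bijective)
  exact ⟨socleEquiv.symm.trans (f.trans quotientEquiv)⟩

/-- The submodule of the elements of `M` annihilated by the two-sided ideal `I`; for `M = R` it is
the right annihilator of `I`. Mathlib's `Submodule.torsionBySet` requires a commutative ring. -/
def annihilatedSubmodule (I : Ideal R) [I.IsTwoSided] (M : Type*) [AddCommGroup M] [Module R M] :
    Submodule R M where
  carrier := {x | ∀ j ∈ I, j • x = 0}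
  zero_mem' j _ := smul_zero j
  add_mem' hx hy j hj := by rw [smul_add, hx j hj, hy j hj, add_zero]
  smul_mem' r x hx j hj := by rw [smul_smul, hx _ (I.mul_mem_right r hj)]

theorem socle_eq_annihilatedSubmodule_jacobson [IsSemisimpleRing (R ⧸ Ring.jacobson R)] :
    socle R M = annihilatedSubmodule (Ring.jacobson R) M := by
  refine le_antisymm (fun x hx j hj => ?_) (le_socle_iff_isSemisimpleModule.2 ?_)
  · have hj_annihilates := IsSemisimpleModule.jacobson_le_annihilator R (socle R M) hj
    exact congrArg Subtype.val (Module.mem_annihilator.1 hj_annihilates ⟨x, hx⟩)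
  · have torsion : Module.IsTorsionBySet R (annihilatedSubmodule (Ring.jacobson R) M)
        (Ring.jacobson R) := fun x j => Subtype.ext (x.2 j j.2)
    let _ := torsion.module
    exact torsion.isSemisimpleModule_iff.1 inferInstance

end Socle

section GeneratingCharacter

variable {R : Type*} [Ring R] {I : Ideal R} [I.IsTwoSided] {χ : AddChar R ℂ}
  {θ : AddChar (R ⧸ I) ℂ} {c : R}

theorem mul_eq_zero_iff_mem_of_forall_apply_mk_eq (hχ : IsLeftNondegenerate χ)
    (hθ : IsLeftNondegenerate θ) (hc : ∀ s, θ (Ideal.Quotient.mk I s) = χ (s * c)) {r : R} :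
    r * c = 0 ↔ r ∈ I := by
  rw [← hχ.forall_apply_mul_eq_one_iff, ← Ideal.Quotient.eq_zero_iff_mem,
    ← hθ.forall_apply_mul_eq_one_iff, Ideal.Quotient.mk_surjective.forall]
  simp only [← map_mul, hc, mul_assoc]

theorem exists_mul_eq_iff_forall_mul_eq_zero [Finite (R ⧸ I)] (hχ : IsLeftNondegenerate χ)
    (hθ : IsLeftNondegenerate θ) (hc : ∀ s, θ (Ideal.Quotient.mk I s) = χ (s * c)) {x : R} :
    (∃ r, r * c = x) ↔ ∀ j ∈ I, j * x = 0 := by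
  constructor
  · rintro ⟨r, rfl⟩ j hj
    rw [← mul_assoc, mul_eq_zero_iff_mem_of_forall_apply_mk_eq hχ hθ hc]
    exact I.mul_mem_right r hj
  · intro hx
    obtain ⟨ψ, hψ⟩ := exists_addChar_quotient_apply_mk_eq I.toAddSubgroup (leftAct x χ)
      fun j hj => show χ (j * x) = 1 by rw [hx j hj, AddChar.map_zero_eq_one]
    obtain ⟨t, ht⟩ := hθ.exists_forall_apply_eq ψ
    obtain ⟨r, rfl⟩ := Ideal.Quotient.mk_surjective t
    refine ⟨r, isLeftNondegenerate_iff_injective_leftAct.1 hχ <| DFunLike.ext _ _ fun s => ?_⟩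
    calc χ (s * (r * c))
      _ = θ (Ideal.Quotient.mk I s * Ideal.Quotient.mk I r) := by
        rw [← mul_assoc, ← hc, map_mul]
      _ = ψ (Ideal.Quotient.mk I s) := (ht _).symm
      _ = χ (s * x) := hψ s

theorem IsLeftNondegenerate.nonempty_annihilatedSubmodule_equiv_quotient [Finite R]
    (hχ : IsLeftNondegenerate χ) (hθ : IsLeftNondegenerate θ) :
    Nonempty (annihilatedSubmodule I R ≃ₗ[R] R ⧸ I) := by
  have : Finite (R ⧸ I) := Quotient.finite _
  obtain ⟨c, hc⟩ := hχ.exists_forall_apply_eq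
    (θ.compAddMonoidHom (Ideal.Quotient.mk I : R →+ R ⧸ I))
  let mulRight : R →ₗ[R] R := LinearMap.toSpanSingleton R R c
  have ker_eq : LinearMap.ker mulRight = I := Submodule.ext fun _ =>
    mul_eq_zero_iff_mem_of_forall_apply_mk_eq hχ hθ hc
  have range_eq : LinearMap.range mulRight = annihilatedSubmodule I R := Submodule.ext fun _ =>
    exists_mul_eq_iff_forall_mul_eq_zero hχ hθ hc
  exact ⟨(LinearEquiv.ofEq _ _ range_eq).symm.trans <|
    mulRight.quotKerEquivRange.symm.trans (Submodule.quotEquivOfEq _ _ ker_eq)⟩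

theorem IsLeftNondegenerate.nonempty_socle_equiv_quotient_jacobson [Finite R]
    (hχ : IsLeftNondegenerate χ) : Nonempty (socle R R ≃ₗ[R] R ⧸ Module.jacobson R R) := by
  have : Finite (R ⧸ Ring.jacobson R) := Quotient.finite _
  obtain ⟨θ, hθ⟩ := exists_isLeftNondegenerate_of_isSemisimpleRing (R ⧸ Ring.jacobson R)
  rw [socle_eq_annihilatedSubmodule_jacobson]
  exact hχ.nonempty_annihilatedSubmodule_equiv_quotient hθ

theorem IsLeftNondegenerate.isFrobeniusRing [Finite R] (hχ : IsLeftNondegenerate χ) :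
    IsFrobeniusRing R where
  artinian_left := inferInstance
  artinian_right := inferInstance
  socle_left := hχ.nonempty_socle_equiv_quotient_jacobson
  socle_right :=
    have : Finite Rᵐᵒᵖ := .of_equiv R MulOpposite.opEquiv
    have hop : IsLeftNondegenerate (opChar χ) :=
      isLeftNondegenerate_opChar_iff.2 (isLeftNondegenerate_iff_isRightNondegenerate.1 hχ)
    nonempty_socle_equiv_quotient_jacobson_congr (MulOpposite.opLinearEquiv Rᵐᵒᵖ).symm
      hop.nonempty_socle_equiv_quotient_jacobson

end GeneratingCharacter

end GenChar

theorem mainTheorem8 {R : Type*} [NonUnitalRing R] [Finite R]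
    (h : ∃ χ : AddChar R ℂ,
      GenChar.IsRightModuleIso (fun r : R => GenChar.rightAct χ r) ∨
      GenChar.IsLeftModuleIso (fun r : R => GenChar.leftAct r χ)) :
    ∃ (e : R) (he : GenChar.IsIdentity e),
      @GenChar.IsFrobeniusRing R (GenChar.ringOfIdentity e he) := by
  obtain ⟨χ, hχ⟩ := h
  have hright : GenChar.IsRightNondegenerate χ := by
    rcases hχ with hχ | hχ
    · exact GenChar.isRightNondegenerate_iff_injective_rightAct.2 hχ.bijective.injective
    · exact GenChar.isLeftNondegenerate_iff_isRightNondegenerate.1 <|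
        GenChar.isLeftNondegenerate_iff_injective_leftAct.2 hχ.bijective.injective
  obtain ⟨e, he⟩ := hright.exists_isIdentity
  have hleft : GenChar.IsLeftNondegenerate χ :=
    GenChar.isLeftNondegenerate_iff_isRightNondegenerate.2 hright
  let _ := GenChar.ringOfIdentity e he
  exact ⟨e, he, GenChar.IsLeftNondegenerate.isFrobeniusRing (χ := χ) hleft⟩
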